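/- Let $L\ge 1$ and consider a ring of cells $1,\dots,L$ (indices are cyclic, so $L+1$ is read as $1$), with a queue $i$ in front of each cell $i$. Let $p_i\in[0,1)$ and $q_{ij}\in[0,1]$ for $i,j\in\{1,\dots,L\}$, with $\prod_{\ell=1}^L(1-q_{\ell j})<1$ for every $j$. The \emph{roundabout chain} is the discrete-time Markov chain on $(\mathbb Z_+\times\{0,1,\dots,L\})^L$ whose state records, for every $i$, the length $Q_i$ of queue $i$ and the state $C_i$ of cell $i$ ($C_i=0$: empty; $C_i=j$: occupied by a vehicle of type $j$). In each time step, independently of everything else, a vehicle arrives at queue $i$ with probability $p_i$, and a type-$j$ vehicle that occupies cell $i$ departs with probability $q_{ij}$. From one time to the next, with all right-hand quantities evaluated at the present time: (1) $Q_i$ decreases by $1$ if $Q_i>0$ and $C_i=0$, and then increases by $1$ if a vehicle arrives at queue $i$; (2) the new state of cell $i+1$ is $i$ if $C_i=0$ and $Q_i>0$; it is $j$ if $C_i=j\ne0$ and the vehicle does not depart; and it is $0$ otherwise. The chain is called positive recurrent if every state $x$ that can be reached from the empty state (all $Q_i=C_i=0$) has finite mean return time, that is, the first time $n\ge1$ at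 which the chain started at $x$ is again at $x$ has finite expectation. For $\ell>L$ put $q_{\ell j}:=q_{ij}$ where $i\in\{1,\dots,L\}$, $i\equiv\ell \pmod L$. Let $T_j$ be the random variable with \[ \mathbb P(T_j=k)=\Bigl(\prod_{\ell=j+1}^{j+k-1}(1-q_{\ell j})\Bigr)\,q_{j+k,j}\qquad(k\ge1), \] the time that a vehicle entering at $j$ spends on the ring, let $N_{ij}$ be the number of $k\in\{1,\dots,T_j\}$ with $j+k\equiv i\pmod L$, the number of its visits to cell $i$, and put $b_{ij}:=\mathbb E N_{ij}$ and $\pi_{i0}:=1-\sum_{j=1}^L b_{ij}\,p_j$. \textbf{Proposition.} If the roundabout chain is positive recurrent, then all $b_{ij}$ are finite and $p_i<\pi_{i0}$ for every $i\in\{1,\dots,L\}$. -/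

import Mathlib

open MeasureTheory ProbabilityTheory
open scoped ENNReal

/-! ## Positive recurrence for Markov kernels -/

namespace MarkovChain

variable {S : Type*} [MeasurableSpace S]

/-- The law, on the space of trajectories `ℕ → S`, of the time-homogeneous Markov chain with
one-step transition kernel `κ` started at `x` at time `0`. -/
noncomputable def pathLaw (κ : Kernel S S) [IsMarkovKernel κ] (x : S) : Measure (ℕ → S) :=
  Kernel.traj (X := fun _ => S)
    (fun n => κ.comap (fun h : (Finset.Iic n → S) => h ⟨n, Finset.mem_Iic.2 le_rfl⟩)
      (measurable_pi_apply _)) 0 (fun _ => x)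

/-- The first time `n ≥ 1` at which the trajectory `ω` is at `x` (`∞` if there is none). -/
noncomputable def returnTime (x : S) (ω : ℕ → S) : ℝ≥0∞ :=
  ⨅ n : {n : ℕ // 1 ≤ n ∧ ω n = x}, ((n : ℕ) : ℝ≥0∞)

/-- A state is positive recurrent if the mean return time to it is finite (in particular the
return time is then almost surely finite). -/
def IsPositiveRecurrent (κ : Kernel S S) [IsMarkovKernel κ] (x : S) : Prop :=
  ∫⁻ ω, returnTime x ω ∂(pathLaw κ x) < ∞

/-- `y` can be reached from `x` by finitely many transitions of positive probability. -/
def Reachable (κ : Kernel S S) : S → S → Prop :=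
  Relation.ReflTransGen (fun x y => 0 < κ x {y})

end MarkovChain

/-! ## The roundabout model -/

/-- Parameters of a roundabout with `L` cells, indexed cyclically by `Fin L`: `p i` is the arrival
probability at queue `i`, and `q i j` is the probability that a type-`j` vehicle occupying cell `i`
departs. -/
structure Roundabout (L : ℕ) where
  p : Fin L → unitInterval
  q : Fin L → Fin L → unitInterval
  p_lt_one : ∀ i, (p i : ℝ) < 1
  exit : ∀ j, ∏ l, (1 - (q l j : ℝ)) < 1

namespace Roundabout

/-- The state of the model: queue lengths, and for every cell either `none` (empty) or `some j`
(occupied by a vehicle of type `j`, i.e. one that entered at `j`). -/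
@[ext]
structure State (L : ℕ) where
  queue : Fin L → ℕ
  cell : Fin L → Option (Fin L)

instance (L : ℕ) : MeasurableSpace (State L) := ⊤

instance (L : ℕ) : DiscreteMeasurableSpace (State L) := ⟨fun _ => trivial⟩

/-- The state in which all queues and all cells are empty. -/
def State.empty (L : ℕ) : State L where
  queue _ := 0
  cell _ := none

/-- The decisions of one time step: `u (i, none)` says whether a vehicle arrives at queue `i`, and
`u (i, some j)` says whether a type-`j` vehicle, if present in cell `i`, departs. -/
abbrev Decisions (L : ℕ) : Type := Fin L × Option (Fin L) → Bool

/-- Length of queue `i` at the next time step. -/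
def nextQueue {L : ℕ} (x : State L) (u : Decisions L) (i : Fin L) : ℕ :=
  x.queue i - (if 0 < x.queue i ∧ x.cell i = none then 1 else 0)
    + (if u (i, none) = true then 1 else 0)

/-- What cell `i` and queue `i` send to the following cell. -/
def output {L : ℕ} (x : State L) (u : Decisions L) (i : Fin L) : Option (Fin L) :=
  match x.cell i with
  | none => if 0 < x.queue i then some i else none
  | some j => if u (i, some j) = true then none else some j

/-- One step of the dynamics; the new state of cell `i + 1` is the output of cell `i`, where the
indices are cyclic. -/
def step {L : ℕ} [NeZero L] (x : State L) (u : Decisions L) : State L where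
  queue i := nextQueue x u i
  cell i := output x u (i - 1)

variable {L : ℕ} (R : Roundabout L)

/-- The success probability of each decision. -/
def decisionProb : Fin L × Option (Fin L) → unitInterval
  | (i, none) => R.p i
  | (i, some j) => R.q i j

/-- All decisions are independent Bernoulli variables. -/
noncomputable def decisionLaw : Measure (Decisions L) :=
  Measure.pi fun k => bernoulliMeasure true false (R.decisionProb k)

instance : IsProbabilityMeasure R.decisionLaw := by
  unfold decisionLaw; infer_instance

variable [NeZero L]

/-- The one-step transition kernel of the roundabout chain. -/
noncomputable def kernel : Kernel (State L) (State L) where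
  toFun x := R.decisionLaw.map (step x)
  measurable' := measurable_from_top

instance : IsMarkovKernel R.kernel :=
  ⟨fun x => Measure.isProbabilityMeasure_map (μ := R.decisionLaw)
    (Measurable.of_discrete (f := step x)).aemeasurable⟩

/-- The roundabout model is stable if its Markov chain, on the set of states that can be reached
from the empty state, is positive recurrent. -/
def IsStable : Prop :=
  ∀ x, MarkovChain.Reachable R.kernel (State.empty L) x → MarkovChain.IsPositiveRecurrent R.kernel x

/-! ### Time on the roundabout and the numbers `π_{ij}` -/

/-- `q_{ℓ j}` for an arbitrary natural number `ℓ`, by reducing `ℓ` modulo `L`. -/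
def qCyc (l : ℕ) (j : Fin L) : ℝ := R.q (Fin.ofNat L l) j

/-- The probability that a vehicle entering at `j` spends exactly `k` time units on the
roundabout. -/
noncomputable def residenceProb (j : Fin L) (k : ℕ) : ℝ :=
  if k = 0 then 0
  else (∏ l ∈ Finset.Ico ((j : ℕ) + 1) (j + k), (1 - R.qCyc l j)) * R.qCyc (j + k) j

lemma residenceProb_nonneg (j : Fin L) (k : ℕ) : 0 ≤ R.residenceProb j k := by
  unfold residenceProb
  split_ifs
  · exact le_rfl
  · exact mul_nonneg (Finset.prod_nonneg fun l _ => sub_nonneg.2 (R.q _ _).2.2) (R.q _ _).2.1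

lemma sum_residenceProb (j : Fin L) (n : ℕ) :
    ∑ k ∈ Finset.range (n + 1), R.residenceProb j k
      = 1 - ∏ l ∈ Finset.Ico ((j : ℕ) + 1) (j + 1 + n), (1 - R.qCyc l j) := by
  induction n with
  | zero => simp [residenceProb]
  | succ n ih =>
    rw [Finset.sum_range_succ, ih, ← add_assoc, Finset.prod_Ico_succ_top (by omega), residenceProb,
      if_neg (by omega), show (j : ℕ) + (n + 1) = j + 1 + n by ring]
    ring

lemma prod_qCyc_block (j : Fin L) (a : ℕ) :
    ∏ l ∈ Finset.Ico a (a + L), (1 - R.qCyc l j) = ∏ l, (1 - (R.q l j : ℝ)) := by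
  induction a with
  | zero =>
    rw [zero_add, ← Finset.range_eq_Ico, Finset.prod_range]
    exact Finset.prod_congr rfl fun i _ => by simp [qCyc]
  | succ a ih =>
    have hL : 0 < L := NeZero.pos L
    rw [← ih, Finset.prod_eq_prod_Ico_succ_bot (show a < a + L by omega),
      show a + 1 + L = (a + L) + 1 by ring, Finset.prod_Ico_succ_top (by omega), mul_comm]
    congr 2
    simp [qCyc, Fin.ofNat]

lemma tendsto_prod_qCyc (j : Fin L) :
    Filter.Tendsto (fun n => ∏ l ∈ Finset.Ico ((j : ℕ) + 1) (j + 1 + n), (1 - R.qCyc l j))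
      Filter.atTop (nhds 0) := by
  have h0 : ∀ l, 0 ≤ 1 - R.qCyc l j := fun l => sub_nonneg.2 (R.q _ _).2.2
  have h1 : ∀ l, 1 - R.qCyc l j ≤ 1 := fun l => sub_le_self _ (R.q _ _).2.1
  have hanti : Antitone
      (fun n => ∏ l ∈ Finset.Ico ((j : ℕ) + 1) (j + 1 + n), (1 - R.qCyc l j)) := by
    refine antitone_nat_of_succ_le fun n => ?_
    rw [← add_assoc, Finset.prod_Ico_succ_top (by omega)]
    exact mul_le_of_le_one_right (Finset.prod_nonneg fun l _ => h0 l) (h1 _)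
  have hpow : ∀ m : ℕ, ∏ l ∈ Finset.Ico ((j : ℕ) + 1) (j + 1 + L * m), (1 - R.qCyc l j)
      = (∏ l, (1 - (R.q l j : ℝ))) ^ m := by
    intro m
    induction m with
    | zero => simp
    | succ m ih =>
      rw [pow_succ, ← ih, ← R.prod_qCyc_block j (j + 1 + L * m), Nat.mul_succ, ← add_assoc,
        Finset.prod_Ico_consecutive _ (by omega) (by omega)]
  refine tendsto_iff_tendsto_subseq_of_antitone hanti
    (φ := fun m => L * m) (Filter.tendsto_id.const_mul_atTop' (NeZero.pos L)) |>.2 ?_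
  simp only [Function.comp_def, hpow]
  exact tendsto_pow_atTop_nhds_zero_of_lt_one
    (Finset.prod_nonneg fun l _ => sub_nonneg.2 (R.q _ _).2.2) (R.exit j)

lemma hasSum_residenceProb (j : Fin L) : HasSum (R.residenceProb j) 1 := by
  rw [hasSum_iff_tendsto_nat_of_nonneg (R.residenceProb_nonneg j),
    ← Filter.tendsto_add_atTop_iff_nat 1]
  simp only [sum_residenceProb]
  simpa using (R.tendsto_prod_qCyc j).const_sub 1

/-- The law of the time `T_j` that a vehicle entering at `j` spends on the roundabout. -/
noncomputable def residenceLaw (j : Fin L) : PMF ℕ :=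
  ⟨fun k => ENNReal.ofReal (R.residenceProb j k), by
    rw [ENNReal.summable.hasSum_iff, ← ENNReal.ofReal_tsum_of_nonneg (R.residenceProb_nonneg j)
      (R.hasSum_residenceProb j).summable, (R.hasSum_residenceProb j).tsum_eq, ENNReal.ofReal_one]⟩

/-- The number of visits to cell `i` of a vehicle that enters at `j` and spends time `t` on the
roundabout: such a vehicle successively occupies the cells `j + 1, …, j + t`. -/
def visits (i j : Fin L) (t : ℕ) : ℕ :=
  ((Finset.Icc 1 t).filter fun k => Fin.ofNat L (j + k) = i).card

/-- `b_{ij}`: the expected number of visits to cell `i` by a vehicle that enters at `j`. -/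
noncomputable def b (i j : Fin L) : ℝ≥0∞ :=
  ∑' t, R.residenceLaw j t * (visits i j t : ℝ≥0∞)

/-- The numbers `π_{ij}`; the index `none` stands for the empty state `0`. -/
noncomputable def load (i : Fin L) : Option (Fin L) → ℝ
  | some j => (R.b i j).toReal * (R.p j : ℝ)
  | none => 1 - ∑ j, (R.b i j).toReal * (R.p j : ℝ)

end Roundabout

/-! Since the empty state is positive recurrent, normalizing the expected visits during one
excursion from it gives an invariant probability law `μ` that charges it
(`IsPositiveRecurrent.exists_invariant`). Under `μ`, rates balance. Queue `i` must release vehicles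
at rate at least `p i` (`arrivalProb_le`). Following type-`j` vehicles round the ring, cell `i` then
holds one with probability at least `p j * b i j` (`arrivalProb_mul_b_le`). The events "cell `i`
holds type `j`", "queue `i` releases a vehicle" and "everything is empty" are disjoint, so the sum
of these bounds and `μ {empty}` is at most 1; positivity of the last term makes the inequality
strict. One-sided bounds suffice, so no moment of the queue lengths under `μ` is required. -/

namespace MarkovChain

/-! ### Invariant measure from the excursions of a positive recurrent state -/

variable {S : Type*}

/-- The trajectories that are not at `x` at any of the times `1, …, n`. -/
def avoidUntil (x : S) (n : ℕ) : Set (ℕ → S) := {ω | ∀ m, 1 ≤ m → m ≤ n → ω m ≠ x}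

lemma avoidUntil_zero (x : S) : avoidUntil x 0 = Set.univ :=
  Set.eq_univ_of_forall fun _ m h h' => by omega

lemma avoidUntil_succ (x : S) (n : ℕ) :
    avoidUntil x (n + 1) = avoidUntil x n ∩ {ω | ω (n + 1) ≠ x} := by
  ext ω
  refine ⟨fun h => ⟨fun m h1 h2 => h m h1 (by omega), h _ (by omega) le_rfl⟩, ?_⟩
  rintro ⟨h, h'⟩ m h1 h2
  rcases Nat.lt_or_ge n m with hm | hm
  · obtain rfl : m = n + 1 := by omega
    exact h'
  · exact h m h1 hm

/-- The time of the first return is at least the number of times before it. -/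
lemma tsum_indicator_avoidUntil_le_returnTime (x : S) (ω : ℕ → S) :
    ∑' n, (avoidUntil x n).indicator (1 : (ℕ → S) → ℝ≥0∞) ω ≤ returnTime x ω := by
  refine le_iInf fun ⟨m, hm, hx⟩ => ?_
  have h0 : ∀ n, n ∉ Finset.range m →
      (avoidUntil x n).indicator (1 : (ℕ → S) → ℝ≥0∞) ω = 0 := by
    intro n hn
    refine Set.indicator_of_notMem (fun h : ω ∈ avoidUntil x n => ?_) _
    exact h m hm (by simpa using hn) hx
  rw [tsum_eq_sum h0]
  calc _ ≤ ∑ _n ∈ Finset.range m, (1 : ℝ≥0∞) :=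
        Finset.sum_le_sum fun n _ => Set.indicator_le_self' (by simp) ω
    _ = m := by simp

variable [MeasurableSpace S] (κ : Kernel S S) [IsMarkovKernel κ] (x : S)

instance : IsProbabilityMeasure (pathLaw κ x) := by
  unfold pathLaw; infer_instance

/-- The Markov property at time `n`. -/
lemma pathLaw_inter_preimage_succ (n : ℕ) {B : Set (Finset.Iic n → S)} (hB : MeasurableSet B)
    {A : Set S} (hA : MeasurableSet A) :
    pathLaw κ x (Preorder.frestrictLe n ⁻¹' B ∩ (fun ω => ω (n + 1)) ⁻¹' A)
      = ∫⁻ ω in Preorder.frestrictLe n ⁻¹' B, κ (ω n) A ∂pathLaw κ x := by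
  have key := Kernel.partialTraj_compProd_eq_map_traj (X := fun _ => S)
    (κ := fun n => κ.comap (fun h : (Finset.Iic n → S) => h ⟨n, Finset.mem_Iic.2 le_rfl⟩)
      (measurable_pi_apply _)) (Nat.zero_le n) (x₀ := fun _ => x)
  have h := congrArg (fun μ => μ (B ×ˢ A)) key
  rw [← Kernel.traj_map_frestrictLe_apply] at h
  rw [Measure.compProd_apply_prod hB hA, Measure.map_apply (by fun_prop) (hB.prod hA),
    setLIntegral_map hB ((Kernel.measurable_coe _ hA)) (by fun_prop)] at h
  exact h.symm

lemma pathLaw_map_zero : (pathLaw κ x).map (fun ω => ω 0) = Measure.dirac x := by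
  have h := Kernel.traj_map_frestrictLe_apply (X := fun _ => S)
    (κ := fun n => κ.comap (fun h : (Finset.Iic n → S) => h ⟨n, Finset.mem_Iic.2 le_rfl⟩)
      (measurable_pi_apply _)) 0 0 (fun _ => x)
  rw [Kernel.partialTraj_self, Kernel.id_apply] at h
  have h2 := congrArg
    (Measure.map (fun h : Finset.Iic 0 → S => h ⟨0, Finset.mem_Iic.2 le_rfl⟩)) h
  rwa [Measure.map_map (by fun_prop) (by fun_prop), Measure.map_dirac' (by fun_prop)] at h2

/-- The law of the state at time `n`, restricted to no return to `x` up to time `n`. -/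
noncomputable def excursionLaw (n : ℕ) : Measure S :=
  ((pathLaw κ x).restrict (avoidUntil x n)).map (fun ω => ω n)

/-- The expected numbers of visits to the states before the return to `x`. -/
noncomputable def cycleMeasure : Measure S := Measure.sum (excursionLaw κ x)

lemma excursionLaw_zero : excursionLaw κ x 0 = Measure.dirac x := by
  rw [excursionLaw, avoidUntil_zero, Measure.restrict_univ, pathLaw_map_zero]

lemma excursionLaw_apply (n : ℕ) {A : Set S} (hA : MeasurableSet A) :
    excursionLaw κ x n A = pathLaw κ x ((fun ω => ω n) ⁻¹' A ∩ avoidUntil x n) := by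
  rw [excursionLaw, Measure.map_apply (by fun_prop) hA,
    Measure.restrict_apply ((by fun_prop : Measurable fun ω : ℕ → S => ω n) hA)]

lemma cycleMeasure_apply {A : Set S} (hA : MeasurableSet A) :
    cycleMeasure κ x A = Measure.dirac x A + ∑' n, excursionLaw κ x (n + 1) A := by
  rw [cycleMeasure, Measure.sum_apply _ hA, tsum_eq_zero_add' ENNReal.summable,
    excursionLaw_zero]

variable [MeasurableSingletonClass S]

/-- Avoidance up to time `n` depends only on the past, which is the form the Markov property takes.
-/
lemma exists_measurableSet_avoidUntil (n : ℕ) : ∃ B : Set (Finset.Iic n → S),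
    MeasurableSet B ∧ avoidUntil x n = Preorder.frestrictLe n ⁻¹' B := by
  refine ⟨⋂ m : Finset.Iic n, {h | 1 ≤ (m : ℕ) → h m ≠ x}, ?_, ?_⟩
  · refine MeasurableSet.iInter fun m => ?_
    by_cases hm : 1 ≤ (m : ℕ)
    · simp only [hm, true_imp_iff]
      exact (measurable_pi_apply m : Measurable fun h : Finset.Iic n → S => h m)
        (measurableSet_singleton x).compl
    · simp [hm]
  · ext ω
    simp only [avoidUntil, Set.mem_ofPred_eq, Set.mem_preimage, Set.mem_iInter]
    exact ⟨fun h m hm => h m hm (Finset.mem_Iic.1 m.2),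
      fun h m h1 h2 => h ⟨m, Finset.mem_Iic.2 h2⟩ h1⟩

lemma measurableSet_avoidUntil (n : ℕ) : MeasurableSet (avoidUntil x n) := by
  obtain ⟨B, hB, h⟩ := exists_measurableSet_avoidUntil x n
  rw [h]
  exact (by fun_prop : Measurable (Preorder.frestrictLe (π := fun _ => S) n)) hB

lemma lintegral_excursionLaw (n : ℕ) {A : Set S} (hA : MeasurableSet A) :
    ∫⁻ y, κ y A ∂excursionLaw κ x n
      = pathLaw κ x (avoidUntil x n ∩ (fun ω => ω (n + 1)) ⁻¹' A) := by
  obtain ⟨B, hB, h⟩ := exists_measurableSet_avoidUntil x n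
  rw [h, pathLaw_inter_preimage_succ κ x n hB hA, excursionLaw, h,
    lintegral_map (Kernel.measurable_coe _ hA) (by fun_prop)]

/-- The next step either continues the excursion or closes it, and in the latter case it lands
exactly at `x`. -/
lemma lintegral_excursionLaw_eq_add (n : ℕ) {A : Set S} (hA : MeasurableSet A) :
    ∫⁻ y, κ y A ∂excursionLaw κ x n = excursionLaw κ x (n + 1) A +
      pathLaw κ x (avoidUntil x n ∩ (fun ω => ω (n + 1)) ⁻¹' {x}) * Measure.dirac x A := by
  have hm : Measurable fun ω : ℕ → S => ω (n + 1) := by fun_prop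
  rw [lintegral_excursionLaw κ x n hA, excursionLaw_apply κ x _ hA,
    ← measure_inter_add_sdiff _ (hm (measurableSet_singleton x)), add_comm]
  congr 1
  · congr 1
    rw [avoidUntil_succ]
    ext ω
    simp only [Set.mem_sdiff, Set.mem_inter_iff, Set.mem_preimage, Set.mem_singleton_iff,
      Set.mem_ofPred_eq]
    tauto
  · rw [Measure.dirac_apply' x hA]
    by_cases hx : x ∈ A
    · rw [Set.indicator_of_mem hx, Pi.one_apply, mul_one]
      congr 1
      ext ω
      simp only [Set.mem_inter_iff, Set.mem_preimage, Set.mem_singleton_iff]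
      exact ⟨fun h => ⟨h.1.1, h.2⟩, fun h => ⟨⟨h.1, h.2 ▸ hx⟩, h.2⟩⟩
    · rw [Set.indicator_of_notMem hx, mul_zero]
      convert measure_empty (μ := pathLaw κ x)
      ext ω
      simp only [Set.mem_inter_iff, Set.mem_preimage, Set.mem_singleton_iff, Set.mem_empty_iff_false,
        iff_false]
      rintro ⟨⟨_, h⟩, h'⟩
      exact hx (h' ▸ h)

/-- Tail-sum formula: the `n`-th excursion law has mass equal to the probability of no return up to
time `n`. -/
lemma cycleMeasure_univ_le : cycleMeasure κ x Set.univ ≤ ∫⁻ ω, returnTime x ω ∂pathLaw κ x := by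
  rw [cycleMeasure, Measure.sum_apply _ MeasurableSet.univ]
  calc ∑' n, excursionLaw κ x n Set.univ
      = ∑' n, ∫⁻ ω, (avoidUntil x n).indicator 1 ω ∂pathLaw κ x := by
        refine tsum_congr fun n => ?_
        rw [excursionLaw_apply κ x n MeasurableSet.univ, Set.preimage_univ, Set.univ_inter,
          lintegral_indicator_one (measurableSet_avoidUntil x n)]
    _ = ∫⁻ ω, ∑' n, (avoidUntil x n).indicator 1 ω ∂pathLaw κ x :=
        (lintegral_tsum fun n =>
          (measurable_one.indicator (measurableSet_avoidUntil x n)).aemeasurable).symm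
    _ ≤ _ := lintegral_mono fun ω => tsum_indicator_avoidUntil_le_returnTime x ω

lemma lintegral_cycleMeasure {A : Set S} (hA : MeasurableSet A) :
    ∫⁻ y, κ y A ∂cycleMeasure κ x = ∑' n, excursionLaw κ x (n + 1) A +
      (∑' n, pathLaw κ x (avoidUntil x n ∩ (fun ω => ω (n + 1)) ⁻¹' {x})) *
        Measure.dirac x A := by
  rw [cycleMeasure, lintegral_sum_measure, ← ENNReal.tsum_mul_right, ← ENNReal.tsum_add]
  exact tsum_congr fun n => lintegral_excursionLaw_eq_add κ x n hA

variable {κ x}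

lemma IsPositiveRecurrent.invariant_cycleMeasure (h : IsPositiveRecurrent κ x) :
    κ.Invariant (cycleMeasure κ x) := by
  have hfin : cycleMeasure κ x Set.univ < ∞ := (cycleMeasure_univ_le κ x).trans_lt h
  -- The return is almost sure by conservation of mass: test against the whole space and cancel the
  -- finite common sum. The mass lost at `x` when the excursion closes then equals the unit mass it
  -- started with.
  have hone : ∑' n, pathLaw κ x (avoidUntil x n ∩ (fun ω => ω (n + 1)) ⁻¹' {x}) = 1 := by
    have h1 := lintegral_cycleMeasure κ x MeasurableSet.univ
    simp only [measure_univ, lintegral_one, mul_one] at h1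
    have h2 := cycleMeasure_apply κ x MeasurableSet.univ
    have h3 : ∑' n, excursionLaw κ x (n + 1) Set.univ ≠ ∞ :=
      ((le_add_self.trans h2.ge).trans_lt hfin).ne
    rw [h2, measure_univ, add_comm] at h1
    exact ((ENNReal.add_right_inj h3).1 h1).symm
  refine Measure.ext fun A hA => ?_
  rw [Measure.bind_apply hA (Kernel.aemeasurable _), lintegral_cycleMeasure κ x hA, hone, one_mul,
    cycleMeasure_apply κ x hA, add_comm]

/-- A positive recurrent state has positive mass under some invariant probability measure. -/
theorem IsPositiveRecurrent.exists_invariant (h : IsPositiveRecurrent κ x) :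
    ∃ μ : Measure S, IsProbabilityMeasure μ ∧ κ.Invariant μ ∧ 0 < μ {x} := by
  have hfin : cycleMeasure κ x Set.univ < ∞ := (cycleMeasure_univ_le κ x).trans_lt h
  have hx : 0 < cycleMeasure κ x {x} := by
    rw [cycleMeasure_apply κ x (measurableSet_singleton x)]
    simp
  have h0 : cycleMeasure κ x Set.univ ≠ 0 := (hx.trans_le (measure_mono (Set.subset_univ _))).ne'
  have : IsFiniteMeasure (cycleMeasure κ x) := ⟨hfin⟩
  have : NeZero (cycleMeasure κ x) := ⟨fun hz => h0 (by simp [hz])⟩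
  refine ⟨(cycleMeasure κ x Set.univ)⁻¹ • cycleMeasure κ x, inferInstance, ?_, ?_⟩
  · rw [Kernel.Invariant, Measure.bind_smul, h.invariant_cycleMeasure.def]
  · rw [Measure.smul_apply, smul_eq_mul]
    exact ENNReal.mul_pos (ENNReal.inv_ne_zero.2 hfin.ne) hx.ne'

end MarkovChain

/-! ### Decision probabilities, survival on the ring and finiteness of the mean visits -/

namespace Roundabout

variable {L : ℕ} (R : Roundabout L)

lemma decisionLaw_preimage_eval (k : Fin L × Option (Fin L)) (s : Set Bool) :
    R.decisionLaw ((fun u => u k) ⁻¹' s) = bernoulliMeasure true false (R.decisionProb k) s := by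
  rw [← (measurePreserving_eval
    (fun k => bernoulliMeasure true false (R.decisionProb k)) k).measure_preimage
      (MeasurableSet.of_discrete (s := s)).nullMeasurableSet]
  rfl

lemma decisionLaw_eq_true (k : Fin L × Option (Fin L)) :
    R.decisionLaw {u | u k = true} = ENNReal.ofReal (R.decisionProb k) := by
  refine (R.decisionLaw_preimage_eval k {true}).trans ?_
  rw [← ofReal_measureReal,
    bernoulliMeasure_real_apply_of_mem_of_notMem _ .of_discrete (by simp) (by simp)]

lemma decisionLaw_eq_false (k : Fin L × Option (Fin L)) :
    R.decisionLaw {u | u k = false} = ENNReal.ofReal (1 - R.decisionProb k) := by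
  refine (R.decisionLaw_preimage_eval k {false}).trans ?_
  rw [← ofReal_measureReal,
    bernoulliMeasure_real_apply_of_notMem_of_mem _ .of_discrete (by simp) (by simp)]

variable [NeZero L]

/-- The probability that a vehicle that enters at `j` spends more than `m` time units on the
roundabout. -/
noncomputable def survivalProb (j : Fin L) (m : ℕ) : ℝ :=
  ∏ l ∈ Finset.Ico ((j : ℕ) + 1) (j + 1 + m), (1 - R.qCyc l j)

lemma survivalProb_nonneg (j : Fin L) (m : ℕ) : 0 ≤ R.survivalProb j m :=
  Finset.prod_nonneg fun _ _ => sub_nonneg.2 (R.q _ _).2.2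

lemma survivalProb_zero (j : Fin L) : R.survivalProb j 0 = 1 := by simp [survivalProb]

lemma survivalProb_succ (j : Fin L) (m : ℕ) :
    R.survivalProb j (m + 1) = (1 - R.qCyc (j + 1 + m) j) * R.survivalProb j m := by
  rw [survivalProb, ← add_assoc, Finset.prod_Ico_succ_top (by omega), mul_comm]
  rfl

lemma survivalProb_add_period (j : Fin L) (m : ℕ) :
    R.survivalProb j (L + m) = (∏ l, (1 - (R.q l j : ℝ))) * R.survivalProb j m := by
  rw [← R.prod_qCyc_block j (j + 1 + m), survivalProb, survivalProb, mul_comm,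
    Finset.prod_Ico_consecutive _ (by omega) (by omega)]
  congr 2
  omega

lemma summable_survivalProb (j : Fin L) : Summable (R.survivalProb j) := by
  have hρ := R.exit j
  set ρ := ∏ l, (1 - (R.q l j : ℝ)) with hρdef
  refine summable_of_sum_range_le (c := (∑ m ∈ Finset.range L, R.survivalProb j m) / (1 - ρ))
    (R.survivalProb_nonneg j) fun n => ?_
  have h : ∑ m ∈ Finset.range (L + n), R.survivalProb j m
      = ∑ m ∈ Finset.range L, R.survivalProb j m
        + ρ * ∑ m ∈ Finset.range n, R.survivalProb j m := by
    rw [Finset.sum_range_add, Finset.mul_sum]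
    exact congrArg _ (Finset.sum_congr rfl fun m _ => R.survivalProb_add_period j m)
  have h' : ∑ m ∈ Finset.range n, R.survivalProb j m
      ≤ ∑ m ∈ Finset.range (L + n), R.survivalProb j m :=
    Finset.sum_le_sum_of_subset_of_nonneg (Finset.range_mono (by omega))
      fun m _ _ => R.survivalProb_nonneg j m
  -- Here `h` and `h'` give `S n ≤ S L + ρ * S n` for the partial sums, where `ρ < 1` is the
  -- probability of surviving a full turn.
  rw [le_div_iff₀ (by linarith)]
  linarith

lemma tsum_residenceLaw_of_lt (j : Fin L) (m : ℕ) :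
    ∑' t, (if m < t then R.residenceLaw j t else 0) = ENNReal.ofReal (R.survivalProb j m) := by
  have h : HasSum (fun t => if m < t then R.residenceProb j t else 0) (R.survivalProb j m) := by
    rw [← hasSum_nat_add_iff' (m + 1), Finset.sum_eq_zero, sub_zero]
    · have h1 := (hasSum_nat_add_iff' (m + 1)).2 (R.hasSum_residenceProb j)
      rw [R.sum_residenceProb j m, sub_sub_cancel, ← survivalProb] at h1
      simpa only [show ∀ t, m < t + (m + 1) by omega, if_true] using h1
    · intro t ht
      rw [if_neg]
      have := Finset.mem_range.1 ht
      omega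
  rw [← h.tsum_eq, ENNReal.ofReal_tsum_of_nonneg _ h.summable]
  · refine tsum_congr fun t => ?_
    split_ifs
    · rfl
    · simp
  · intro t
    split_ifs
    · exact R.residenceProb_nonneg j t
    · exact le_rfl

/-- Write the visit count as a sum of indicators and exchange the sums: time `m + 1` on the ring is
reached exactly when the residence time exceeds `m`. -/
lemma b_eq_tsum (i j : Fin L) : R.b i j = ∑' m : ℕ,
    if Fin.ofNat L (j + 1 + m) = i then ENNReal.ofReal (R.survivalProb j m) else 0 := by
  have hv : ∀ t, (visits i j t : ℝ≥0∞) =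
      ∑' m : ℕ, if m < t ∧ Fin.ofNat L (j + 1 + m) = i then 1 else 0 := by
    intro t
    rw [tsum_eq_sum (s := Finset.range t)
        (fun m hm => if_neg fun h => hm (Finset.mem_range.2 h.1)), visits, Finset.card_filter,
      Nat.cast_sum, show Finset.Icc 1 t = Finset.Ico 1 (t + 1) from rfl,
      Finset.sum_Ico_eq_sum_range, Nat.add_sub_cancel]
    refine Finset.sum_congr rfl fun m hm => ?_
    simp only [Finset.mem_range.1 hm, true_and, add_assoc, Nat.cast_ite, Nat.cast_one,
      Nat.cast_zero]
  simp_rw [b, hv, ← ENNReal.tsum_mul_left]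
  rw [ENNReal.tsum_comm]
  refine tsum_congr fun m => ?_
  rw [← R.tsum_residenceLaw_of_lt j m]
  by_cases h : Fin.ofNat L (j + 1 + m) = i <;>
    simp only [h, and_true, and_false, if_true, if_false, mul_ite, mul_one, mul_zero, tsum_zero]

lemma b_lt_top (i j : Fin L) : R.b i j < ⊤ := by
  rw [b_eq_tsum]
  refine lt_of_le_of_lt (ENNReal.tsum_le_tsum fun m => ?_)
    (R.summable_survivalProb j).tsum_ofReal_lt_top
  split_ifs
  · exact le_rfl
  · exact zero_le

lemma ofNat_succ (n : ℕ) : Fin.ofNat L (n + 1) = Fin.ofNat L n + 1 := by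
  ext
  simp [Fin.val_add]

/-! ### Rate balances under an invariant law -/

variable {R} {μ : Measure (State L)}

lemma lintegral_step_of_invariant (h : R.kernel.Invariant μ) (f : State L → ℝ≥0∞) :
    ∫⁻ x, ∫⁻ u, f (step x u) ∂decisionLaw R ∂μ = ∫⁻ x, f x ∂μ := by
  conv_rhs => rw [← h.def]
  rw [Measure.lintegral_bind (Kernel.aemeasurable _) measurable_from_top.aemeasurable]
  refine lintegral_congr fun x => ?_
  exact (lintegral_map measurable_from_top (Measurable.of_discrete (f := step x))).symm

/-- A type-`j` vehicle in the next cell either stayed on the ring from cell `i` or, only if `i = j`,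
has just entered from the queue. -/
lemma measure_cell_eq_some (h : R.kernel.Invariant μ) (i j : Fin L) :
    μ {x | x.cell (i + 1) = some j} =
      ENNReal.ofReal (1 - R.q i j) * μ {x | x.cell i = some j} +
        if i = j then μ {x | x.cell i = none ∧ 0 < x.queue i} else 0 := by
  classical
  rw [← lintegral_indicator_one .of_discrete, ← lintegral_step_of_invariant h]
  have key : ∀ x : State L,
      ∫⁻ u, {x : State L | x.cell (i + 1) = some j}.indicator 1 (step x u) ∂decisionLaw R
        = ENNReal.ofReal (1 - R.q i j) * {x : State L | x.cell i = some j}.indicator 1 x +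
          if i = j then {x : State L | x.cell i = none ∧ 0 < x.queue i}.indicator 1 x else 0 := by
    intro x
    have h1 : ∫⁻ u, {x : State L | x.cell (i + 1) = some j}.indicator 1 (step x u) ∂decisionLaw R
        = R.decisionLaw {u | output x u i = some j} := by
      rw [← lintegral_indicator_one .of_discrete]
      refine lintegral_congr fun u => ?_
      simp [Set.indicator_apply, step]
    rw [h1]
    rcases hc : x.cell i with _ | j'
    · by_cases hq : 0 < x.queue i
      · by_cases hij : i = j
        · subst hij
          simp [output, hc, hq]
        · simp [output, hc, hq, hij]
      · simp [output, hc, hq]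
    · by_cases hj : j' = j
      · subst hj
        simpa [output, hc, decisionProb] using R.decisionLaw_eq_false (i, some j')
      · simp [output, hc, hj]
  simp_rw [key]
  rw [lintegral_add_left measurable_from_top, lintegral_const_mul _ measurable_from_top,
    lintegral_indicator_one .of_discrete]
  split_ifs
  · rw [lintegral_indicator_one .of_discrete]
  · rw [lintegral_zero]

/-- The queue is truncated at `k` so that all terms have finite mean. -/
lemma min_queue_add_le (x : State L) (u : Decisions L) (i : Fin L) (k : ℕ) :
    min (x.queue i) k + (if u (i, none) = true ∧ x.queue i < k then 1 else 0) ≤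
      min ((step x u).queue i) k + if x.cell i = none ∧ 0 < x.queue i then 1 else 0 := by
  by_cases h1 : u (i, none) = true <;> by_cases h2 : x.cell i = none <;>
    by_cases h3 : 0 < x.queue i <;> by_cases h4 : x.queue i < k <;>
    simp [step, nextQueue, h1, h2, h3, h4] <;> omega

variable [IsProbabilityMeasure μ]

/-- In equilibrium the truncated queue has zero mean drift, so the arrivals it counts cannot exceed
the departures. -/
lemma arrivalProb_mul_le (h : R.kernel.Invariant μ) (i : Fin L) (k : ℕ) :
    ENNReal.ofReal (R.p i) * μ {x | x.queue i < k}
      ≤ μ {x | x.cell i = none ∧ 0 < x.queue i} := by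
  classical
  have hstep : ∀ x : State L, ((min (x.queue i) k : ℕ) : ℝ≥0∞) +
      ENNReal.ofReal (R.p i) * {x : State L | x.queue i < k}.indicator 1 x ≤
      ∫⁻ u, ((min ((step x u).queue i) k : ℕ) : ℝ≥0∞) ∂decisionLaw R +
        {x : State L | x.cell i = none ∧ 0 < x.queue i}.indicator 1 x := by
    intro x
    have := lintegral_mono (μ := R.decisionLaw) fun u =>
      (Nat.cast_le (α := ℝ≥0∞)).2 (min_queue_add_le x u i k)
    simp only [Nat.cast_add] at this
    rw [lintegral_add_left (by fun_prop), lintegral_add_left .of_discrete] at this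
    have hA : ∫⁻ u, (((if u (i, none) = true ∧ x.queue i < k then 1 else 0 : ℕ)) : ℝ≥0∞)
        ∂decisionLaw R
        = ENNReal.ofReal (R.p i) * {x : State L | x.queue i < k}.indicator 1 x := by
      have h1 := R.decisionLaw_eq_true (i, none)
      rw [← lintegral_indicator_one .of_discrete, decisionProb] at h1
      by_cases hk : x.queue i < k
      · simp only [hk, and_true, Set.indicator_apply, Set.mem_ofPred_eq, if_true, Pi.one_apply,
          mul_one] at h1 ⊢
        simpa using h1
      · simp [hk]
    rw [hA] at this
    simpa [Set.indicator_apply] using this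
  have := lintegral_mono (μ := μ) hstep
  rw [lintegral_add_left measurable_from_top, lintegral_add_left measurable_from_top,
    lintegral_step_of_invariant h (fun x => ((min (x.queue i) k : ℕ) : ℝ≥0∞)),
    lintegral_const_mul _ measurable_from_top, lintegral_indicator_one .of_discrete,
    lintegral_indicator_one .of_discrete] at this
  -- Cancelling the mean of the truncated queue is legitimate because it is at most `k`; the
  -- untruncated mean might be infinite.
  refine (ENNReal.add_le_add_iff_left ?_).1 this
  refine ne_top_of_le_ne_top (ENNReal.natCast_ne_top k) ?_
  calc _ ≤ ∫⁻ _, (k : ℝ≥0∞) ∂μ := lintegral_mono fun x => by simp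
    _ = k := by simp

/-- In a stationary regime vehicles enter from each queue at least at the arrival rate. -/
lemma arrivalProb_le (h : R.kernel.Invariant μ) (i : Fin L) :
    ENNReal.ofReal (R.p i) ≤ μ {x | x.cell i = none ∧ 0 < x.queue i} := by
  have hmono : Monotone fun k => {x : State L | x.queue i < k} :=
    fun a b hab x (hx : x.queue i < a) => hx.trans_le hab
  have hlim := tendsto_measure_iUnion_atTop (μ := μ) hmono
  have huniv : ⋃ k, {x : State L | x.queue i < k} = Set.univ :=
    Set.eq_univ_of_forall fun x => Set.mem_iUnion.2 ⟨x.queue i + 1, Nat.lt_succ_self _⟩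
  rw [huniv, measure_univ] at hlim
  have hlim' := ENNReal.Tendsto.const_mul (a := ENNReal.ofReal (R.p i)) hlim (Or.inl one_ne_zero)
  rw [mul_one] at hlim'
  exact le_of_tendsto' hlim' (arrivalProb_mul_le h i)

/-- Iterating the cell balance backwards `n` times keeps only the vehicles that entered within the
last `n` steps; discarding older ones gives the inequality. -/
lemma arrivalProb_mul_sum_le (h : R.kernel.Invariant μ) (j : Fin L) (n : ℕ) (i : Fin L) :
    ENNReal.ofReal (R.p j) * ∑ m ∈ Finset.range n,
      (if Fin.ofNat L (j + 1 + m) = i then ENNReal.ofReal (R.survivalProb j m) else 0)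
      ≤ μ {x | x.cell i = some j} := by
  induction n generalizing i with
  | zero => simp
  | succ n ih =>
    obtain ⟨i, rfl⟩ : ∃ i', i = i' + 1 := ⟨i - 1, (sub_add_cancel i 1).symm⟩
    have hsum : ∑ m ∈ Finset.range n, (if Fin.ofNat L (j + 1 + (m + 1)) = i + 1 then
        ENNReal.ofReal (R.survivalProb j (m + 1)) else 0)
        = ENNReal.ofReal (1 - R.q i j) * ∑ m ∈ Finset.range n,
          (if Fin.ofNat L (j + 1 + m) = i then ENNReal.ofReal (R.survivalProb j m) else 0) := by
      rw [Finset.mul_sum]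
      refine Finset.sum_congr rfl fun m _ => ?_
      rw [← add_assoc, ofNat_succ]
      simp only [add_left_inj]
      split_ifs with him
      · rw [survivalProb_succ, qCyc, him, ENNReal.ofReal_mul (sub_nonneg.2 (R.q _ _).2.2)]
      · rw [mul_zero]
    -- The `m = 0` term is the entry term of the balance; the other terms come from the preceding
    -- cell.
    have hzero : (Fin.ofNat L (j + 1 + 0) = i + 1) ↔ i = j := by
      rw [add_zero, ofNat_succ, add_left_inj, Fin.ofNat_val_eq_self, eq_comm]
    rw [Finset.sum_range_succ', hsum, survivalProb_zero, ENNReal.ofReal_one, mul_add,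
      measure_cell_eq_some h, mul_left_comm]
    refine add_le_add (mul_le_mul_right (ih i) _) ?_
    simp only [hzero]
    split_ifs with hij
    · rw [mul_one, ← hij]
      exact arrivalProb_le h i
    · simp

/-- Little's law for the vehicles in a cell, in the form of an inequality. -/
lemma arrivalProb_mul_b_le (h : R.kernel.Invariant μ) (i j : Fin L) :
    ENNReal.ofReal (R.p j) * R.b i j ≤ μ {x | x.cell i = some j} := by
  rw [b_eq_tsum]
  have hlim := ENNReal.Tendsto.const_mul (a := ENNReal.ofReal (R.p j))
    (ENNReal.summable (f := fun m : ℕ => if Fin.ofNat L (j + 1 + m) = i then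
      ENNReal.ofReal (R.survivalProb j m) else 0)).hasSum.tendsto_sum_nat
    (Or.inr ENNReal.ofReal_ne_top)
  exact le_of_tendsto' hlim fun n => arrivalProb_mul_sum_le h j n i

lemma sum_arrivalProb_mul_b_add_le (h : R.kernel.Invariant μ) (i : Fin L) :
    ∑ j, ENNReal.ofReal (R.p j) * R.b i j + ENNReal.ofReal (R.p i) + μ {State.empty L} ≤ 1 := by
  have htotal := sum_measure_preimage_singleton (μ := μ) (f := fun x : State L => x.cell i)
    Finset.univ (fun _ _ => .of_discrete)
  rw [Finset.coe_univ, Set.preimage_univ, measure_univ, Fintype.sum_option] at htotal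
  -- The empty state has an empty cell `i` but releases nothing, so it adds to the entry event; this
  -- is the source of strictness.
  have hnone : μ {x : State L | x.cell i = none ∧ 0 < x.queue i} + μ {State.empty L}
      ≤ μ ((fun x : State L => x.cell i) ⁻¹' {none}) := by
    rw [← measure_union _ .of_discrete]
    · refine measure_mono ?_
      rintro x (⟨hx, _⟩ | rfl)
      · exact hx
      · rfl
    · rw [Set.disjoint_singleton_right]
      exact fun hx => absurd hx.2 (lt_irrefl 0)
  rw [← htotal, add_assoc, add_comm]
  exact add_le_add ((add_le_add_left (arrivalProb_le h i) _).trans hnone)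
    (Finset.sum_le_sum fun j _ => arrivalProb_mul_b_le h i j)

end Roundabout

/-- If the roundabout chain is positive recurrent, then (all the means `b_{ij}` being finite)
`p_i < π_{i0} = 1 - ∑_j b_{ij} p_j` for every `i`. -/
theorem mainTheorem3 {L : ℕ} [NeZero L] (R : Roundabout L) (h : R.IsStable) :
    (∀ i j, R.b i j < ⊤) ∧ ∀ i, (R.p i : ℝ) < R.load i none := by
  refine ⟨R.b_lt_top, fun i => ?_⟩
  obtain ⟨μ, _, hinv, hpos⟩ := (h _ Relation.ReflTransGen.refl).exists_invariant
  have hle := ENNReal.toReal_mono ENNReal.one_ne_top (R.sum_arrivalProb_mul_b_add_le hinv i)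
  have hb : ∀ j ∈ Finset.univ, ENNReal.ofReal (R.p j) * R.b i j ≠ ∞ :=
    fun j _ => ENNReal.mul_ne_top ENNReal.ofReal_ne_top (R.b_lt_top i j).ne
  rw [ENNReal.toReal_add (ENNReal.add_ne_top.2 ⟨ENNReal.sum_ne_top.2 hb, ENNReal.ofReal_ne_top⟩)
      (measure_ne_top _ _), ENNReal.toReal_add (ENNReal.sum_ne_top.2 hb) ENNReal.ofReal_ne_top,
    ENNReal.toReal_sum hb, ENNReal.toReal_ofReal (R.p i).2.1, ENNReal.toReal_one] at hle
  simp only [ENNReal.toReal_mul, ENNReal.toReal_ofReal (R.p _).2.1] at hle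
  have hpos' := ENNReal.toReal_pos hpos.ne' (measure_ne_top _ _)
  simp only [Roundabout.load, mul_comm (R.b i _).toReal]
  linarith
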